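/- **Notation.** For $A\in M_n(\mathbb C)$ and $\theta\in\mathbb R$ put $H_\theta(A)=\tfrac12(e^{i\theta}A+e^{-i\theta}A^*)$. This matrix is Hermitian; let $\lambda_1(H_\theta(A))\ge\cdots\ge\lambda_n(H_\theta(A))$ be its eigenvalues. For $c=(c_1,\dots,c_n)\in\mathbb R^n$ the weighted numerical range of $A$ is $$W(A;c)=\bigcap_{\theta}\Big\{v\in\mathbb C:\ \operatorname{Re}(e^{i\theta}v)\le \sum_{j=1}^n c_j\lambda_j(H_\theta(A))\Big\}.$$ Let $\lambda_1(A),\dots,\lambda_n(A)$ be the eigenvalues of $A$ with algebraic multiplicity. A $c$-value of $A$ is a number $\sum_{j=1}^n c_j\lambda_{\sigma(j)}(A)$ with $\sigma$ a permutation of $\{1,\dots,n\}$. The $c$-polynomial of $A$ is $$p(A;c)(t)=\prod_{e}\Big(t-\sum_{j=1}^n e_j\lambda_j(A)\Big),$$ where $e$ runs over the distinct rearrangements of the tuple $c$; put $\deg(A;c)=\deg p(A;c)$. Let $r(A;c)\in\mathbb C[x,y,t]$ be the polynomial with $r(A;c)(x,y,t)=p(xA+yA^*;c)(t)$ for all $x,y,t\in\mathbb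 C$. Write $\partial$ for the topological boundary in $\mathbb C$, and $[z,w]$ for the closed line segment from $z$ to $w$. **Theorem.** Let $A\in M_n(\mathbb C)$, $B\in M_m(\mathbb C)$, $c\in\mathbb R^n$ and $d\in\mathbb R^m$, and let $k=\deg(A;c)\deg(B;d)+1$. Suppose there are points $z_1,\dots,z_k\in\partial W(A;c)\cap\partial W(B;d)$ such that for all $r\ne s$ the segment $[z_r,z_s]$ is not contained in $\partial W(A;c)\cap\partial W(B;d)$. Then there exists a $c$-value of $A$ which is also a $d$-value of $B$. Furthermore, if $r(A;c)$ is irreducible in $\mathbb C[x,y,t]$, then every $c$-value of $A$ is a $d$-value of $B$. -/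

import Mathlib

open scoped Matrix

namespace WeightedNR

noncomputable section

/-- `H_θ(A) = (e^{iθ} A + e^{-iθ} A^*) / 2`. -/
def rotHerm {n : ℕ} (A : Matrix (Fin n) (Fin n) ℂ) (θ : ℝ) : Matrix (Fin n) (Fin n) ℂ :=
  (1 / 2 : ℂ) • (Complex.exp (θ * Complex.I) • A + Complex.exp (-(θ * Complex.I)) • Aᴴ)

theorem rotHerm_isHermitian {n : ℕ} (A : Matrix (Fin n) (Fin n) ℂ) (θ : ℝ) :
    (rotHerm A θ).IsHermitian := by
  have h1 : star (Complex.exp (θ * Complex.I)) = Complex.exp (-(θ * Complex.I)) := by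
    rw [Complex.star_def, ← Complex.exp_conj]; simp
  have h2 : star (Complex.exp (-(θ * Complex.I))) = Complex.exp (θ * Complex.I) := by
    rw [← h1, star_star]
  unfold Matrix.IsHermitian rotHerm
  rw [Matrix.conjTranspose_smul, Matrix.conjTranspose_add, Matrix.conjTranspose_smul,
    Matrix.conjTranspose_smul, h1, h2, Matrix.conjTranspose_conjTranspose, add_comm]
  simp

/-- The eigenvalues `λ_1 ≥ λ_2 ≥ ⋯ ≥ λ_n` of the Hermitian matrix `H_θ(A)`, in decreasing order and
repeated according to multiplicity (with indices starting at `0`). -/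
def sortedEig {n : ℕ} (A : Matrix (Fin n) (Fin n) ℂ) (θ : ℝ) (j : Fin n) : ℝ :=
  (rotHerm_isHermitian A θ).eigenvalues₀ (Fin.cast (Fintype.card_fin n).symm j)

/-- `c_1 λ_1(H_θ(A)) + ⋯ + c_n λ_n(H_θ(A))`. -/
def supportValue {n : ℕ} (A : Matrix (Fin n) (Fin n) ℂ) (c : Fin n → ℝ) (θ : ℝ) : ℝ :=
  ∑ j, c j * sortedEig A θ j

/-- The weighted numerical range
`W(A;c) = ⋂_θ {v : Re (e^{iθ} v) ≤ c_1 λ_1(H_θ(A)) + ⋯ + c_n λ_n(H_θ(A))}`.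
The condition is `2π`-periodic in `θ`, so all real `θ` are allowed. -/
def weightedRange {n : ℕ} (A : Matrix (Fin n) (Fin n) ℂ) (c : Fin n → ℝ) : Set ℂ :=
  ⋂ θ : ℝ, {v : ℂ | (Complex.exp (θ * Complex.I) * v).re ≤ supportValue A c θ}

theorem length_roots {n : ℕ} (A : Matrix (Fin n) (Fin n) ℂ) :
    A.charpoly.roots.toList.length = n := by
  rw [Multiset.length_toList, IsAlgClosed.card_roots_eq_natDegree,
    Matrix.charpoly_natDegree_eq_dim, Fintype.card_fin]

/-- The eigenvalues `λ_1(A), …, λ_n(A)` of `A`, repeated according to algebraic multiplicity, in some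
order; nothing below depends on that order. -/
def eig {n : ℕ} (A : Matrix (Fin n) (Fin n) ℂ) (j : Fin n) : ℂ :=
  A.charpoly.roots.toList.get (Fin.cast (length_roots A).symm j)

theorem map_eig {n : ℕ} (A : Matrix (Fin n) (Fin n) ℂ) :
    (Finset.univ.val.map (eig A)) = A.charpoly.roots := by
  conv_rhs => rw [← Multiset.coe_toList A.charpoly.roots]
  rw [Fin.univ_val_map]
  congr 1
  apply List.ext_get
  · rw [length_roots, List.length_ofFn]
  · intro k h1 h2
    simp [eig]

/-- `μ` is a `c`-value of `A`: a sum `c_{i_1} λ_{j_1}(A) + ⋯ + c_{i_r} λ_{j_r}(A)` over the nonzero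
entries of `c`, with distinct `j_1, …, j_r`. Entries of `c` that vanish contribute nothing and an
injective choice of indices extends to a permutation, so permutations of all indices are used. -/
def IsCValue {n : ℕ} (A : Matrix (Fin n) (Fin n) ℂ) (c : Fin n → ℝ) (μ : ℂ) : Prop :=
  ∃ σ : Equiv.Perm (Fin n), μ = ∑ j, (c j : ℂ) * eig A (σ j)

/-- The distinct rearrangements of `c`. They index the generically distinct `c`-values. -/
def rearrangements {n : ℕ} (c : Fin n → ℝ) : Finset (Fin n → ℝ) :=
  Finset.univ.image fun σ : Equiv.Perm (Fin n) => c ∘ σ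

/-- The `c`-polynomial `p(A;c)(t)`, whose roots are the generically distinct `c`-values of `A`: one
factor for each formally distinct sum `∑ e_j λ_j`, with `e` a rearrangement of `c`. -/
def cPoly {n : ℕ} (A : Matrix (Fin n) (Fin n) ℂ) (c : Fin n → ℝ) : Polynomial ℂ :=
  ∏ e ∈ rearrangements c, (Polynomial.X - Polynomial.C (∑ j, (e j : ℂ) * eig A j))

/-- `deg(A;c) = deg p(A;c)`. -/
def cDeg {n : ℕ} (A : Matrix (Fin n) (Fin n) ℂ) (c : Fin n → ℝ) : ℕ :=
  (cPoly A c).natDegree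

theorem cDeg_eq_card {n : ℕ} (A : Matrix (Fin n) (Fin n) ℂ) (c : Fin n → ℝ) :
    cDeg A c = (rearrangements c).card := by
  unfold cDeg cPoly
  rw [Polynomial.natDegree_prod_of_monic _ _ fun e _ => Polynomial.monic_X_sub_C _]
  simp only [Polynomial.natDegree_X_sub_C, Finset.sum_const, smul_eq_mul, mul_one]

theorem isRoot_cPoly {n : ℕ} (A : Matrix (Fin n) (Fin n) ℂ) (c : Fin n → ℝ) (μ : ℂ) :
    (cPoly A c).IsRoot μ ↔ IsCValue A c μ := by
  unfold cPoly IsCValue rearrangements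
  rw [Polynomial.IsRoot, Polynomial.eval_prod, Finset.prod_eq_zero_iff]
  simp only [Finset.mem_image, Finset.mem_univ, true_and, Polynomial.eval_sub, Polynomial.eval_X,
    Polynomial.eval_C, sub_eq_zero]
  constructor
  · rintro ⟨_, ⟨σ, rfl⟩, h⟩
    refine ⟨σ⁻¹, ?_⟩
    rw [h, ← Equiv.sum_comp σ (fun j => (c j : ℂ) * eig A (σ⁻¹ j))]
    simp
  · rintro ⟨σ, h⟩
    refine ⟨_, ⟨σ.symm, rfl⟩, ?_⟩
    rw [h, ← Equiv.sum_comp σ (fun j => (((c ∘ σ.symm) j : ℝ) : ℂ) * eig A j)]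
    simp

/-- `p(xA + yA^*;c)(t)` is a polynomial function of `(x, y, t)`. -/
theorem exists_rPoly {n : ℕ} (A : Matrix (Fin n) (Fin n) ℂ) (c : Fin n → ℝ) :
    ∃ r : MvPolynomial (Fin 3) ℂ, ∀ x y t : ℂ,
      MvPolynomial.eval ![x, y, t] r = (cPoly (x • A + y • Aᴴ) c).eval t := by
  classical
  let P : MvPolynomial (Fin n) (Polynomial ℂ) := ∏ e ∈ rearrangements c,
    (MvPolynomial.C Polynomial.X -
      ∑ j, MvPolynomial.C (Polynomial.C (e j : ℂ)) * MvPolynomial.X j)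
  have hP : P.IsSymmetric := by
    intro σ
    simp only [P, map_prod, map_sub, map_sum, map_mul, MvPolynomial.rename_C,
      MvPolynomial.rename_X]
    refine Finset.prod_bij' (fun e _ => e ∘ σ.symm) (fun e _ => e ∘ σ) ?_ ?_ ?_ ?_ ?_
    · intro e he
      simp only [rearrangements, Finset.mem_image, Finset.mem_univ, true_and] at he ⊢
      obtain ⟨τ, rfl⟩ := he
      exact ⟨σ.symm.trans τ, rfl⟩
    · intro e he
      simp only [rearrangements, Finset.mem_image, Finset.mem_univ, true_and] at he ⊢
      obtain ⟨τ, rfl⟩ := he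
      exact ⟨σ.trans τ, rfl⟩
    · intro e _; ext j; simp
    · intro e _; ext j; simp
    · intro e _
      congr 1
      rw [← Equiv.sum_comp σ (fun j => MvPolynomial.C (Polynomial.C (((e ∘ σ.symm) j : ℝ) : ℂ)) *
        MvPolynomial.X j)]
      simp
  obtain ⟨Q, hQ⟩ := (MvPolynomial.esymmAlgHom_fin_bijective (Polynomial ℂ) n).2 ⟨P, hP⟩
  have hQ' : MvPolynomial.aeval
      (fun i : Fin n => MvPolynomial.esymm (Fin n) (Polynomial ℂ) (i + 1)) Q = P := by
    rw [← MvPolynomial.esymmAlgHom_apply, hQ]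
  let G : Matrix (Fin n) (Fin n) (MvPolynomial (Fin 3) ℂ) :=
    (MvPolynomial.X 0 : MvPolynomial (Fin 3) ℂ) • A.map MvPolynomial.C +
      (MvPolynomial.X 1 : MvPolynomial (Fin 3) ℂ) • Aᴴ.map MvPolynomial.C
  let φ : Polynomial ℂ →+* MvPolynomial (Fin 3) ℂ :=
    Polynomial.eval₂RingHom MvPolynomial.C (MvPolynomial.X 2)
  refine ⟨MvPolynomial.eval₂ φ
    (fun i : Fin n => (-1) ^ ((i : ℕ) + 1) * G.charpoly.coeff (n - (i + 1))) Q, ?_⟩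
  intro x y t
  set M := x • A + y • Aᴴ with hM
  have hG : G.map (MvPolynomial.eval ![x, y, t]) = M := by
    ext i j
    simp [G, hM]
  have hφ : (MvPolynomial.eval ![x, y, t]).comp φ = Polynomial.evalRingHom t := by
    apply Polynomial.ringHom_ext <;> simp [φ]
  have hco : ∀ i : Fin n, MvPolynomial.eval ![x, y, t]
      ((-1) ^ ((i : ℕ) + 1) * G.charpoly.coeff (n - (i + 1))) =
      (Finset.univ.val.map (eig M)).esymm (i + 1) := by
    intro i
    have h1 : MvPolynomial.eval ![x, y, t] (G.charpoly.coeff (n - (i + 1))) =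
        M.charpoly.coeff (n - (i + 1)) := by
      rw [← hG, Matrix.charpoly_map, Polynomial.coeff_map]
    have hd : M.charpoly.natDegree = n := by
      rw [Matrix.charpoly_natDegree_eq_dim, Fintype.card_fin]
    have h2 := Polynomial.coeff_eq_esymm_roots_of_splits (IsAlgClosed.splits M.charpoly)
      (k := n - (i + 1)) (by omega)
    have h3 : n - (n - ((i : ℕ) + 1)) = i + 1 := by omega
    rw [map_mul, map_pow, map_neg, map_one, h1, h2, hd, h3, (Matrix.charpoly_monic M).leadingCoeff,
      map_eig, one_mul, ← mul_assoc, ← mul_pow]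
    simp
  have key : MvPolynomial.eval₂ (Polynomial.evalRingHom t) (eig M) P =
      MvPolynomial.eval₂ (Polynomial.evalRingHom t)
        (fun i : Fin n => (Finset.univ.val.map (eig M)).esymm (i + 1)) Q := by
    rw [← hQ', MvPolynomial.aeval_def, ← MvPolynomial.coe_eval₂Hom, MvPolynomial.hom_eval₂]
    congr 1
    · ext <;> simp
    · funext i
      simp only [MvPolynomial.coe_eval₂Hom, MvPolynomial.esymm, MvPolynomial.eval₂_sum,
        MvPolynomial.eval₂_prod, MvPolynomial.eval₂_X, Finset.esymm_map_val]
  have hl : MvPolynomial.eval₂ (Polynomial.evalRingHom t) (eig M) P = (cPoly M c).eval t := by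
    simp [P, cPoly, Polynomial.eval_prod, Polynomial.eval_finsetSum]
  rw [← hl, key, MvPolynomial.hom_eval₂, hφ]
  congr 1
  funext i
  exact hco i

/-- `r(A;c)(x,y,t) = p(xA + yA^*;c)(t)` as a polynomial in the three variables `x, y, t` over `ℂ`. It
is the only polynomial with these values, see `rPoly_unique`. -/
def rPoly {n : ℕ} (A : Matrix (Fin n) (Fin n) ℂ) (c : Fin n → ℝ) : MvPolynomial (Fin 3) ℂ :=
  (exists_rPoly A c).choose

theorem eval_rPoly {n : ℕ} (A : Matrix (Fin n) (Fin n) ℂ) (c : Fin n → ℝ) (x y t : ℂ) :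
    MvPolynomial.eval ![x, y, t] (rPoly A c) = (cPoly (x • A + y • Aᴴ) c).eval t :=
  (exists_rPoly A c).choose_spec x y t

theorem rPoly_unique {n : ℕ} (A : Matrix (Fin n) (Fin n) ℂ) (c : Fin n → ℝ)
    (r : MvPolynomial (Fin 3) ℂ)
    (h : ∀ x y t : ℂ, MvPolynomial.eval ![x, y, t] r = (cPoly (x • A + y • Aᴴ) c).eval t) :
    r = rPoly A c := by
  apply MvPolynomial.funext
  intro v
  have hv : v = ![v 0, v 1, v 2] := by
    ext i; fin_cases i <;> rfl
  rw [hv, h, eval_rPoly]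

end

end WeightedNR

/-! The proof passes to dual curves and applies Bézout's theorem. The support value `h` of `W(A;c)`
in direction `θ` is a `c`-value of `H_θ(A)`. Since `A + e^{-2iθ}A^* = 2e^{-iθ}H_θ(A)`, the point
`(1, e^{-2iθ}, 2he^{-iθ})` is a zero of `r(A;c)`, a form of degree `deg(A;c)`
(`eval_rPoly_dual_point`, `isHomogeneous_rPoly`).

Each `z_r` yields a direction in which both ranges have the same support value and which separates
`z_r` strictly from the other points (`exists_common_supportValue`). Separation makes the resulting
common zeros of `r(A;c)` and `r(B;d)` distinct (`eq_of_dual_point_eq`). There are more of them than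
the product of the degrees, so a resultant vanishes identically and the curves meet on every line `y
= const` of the chart `x = 1` (`exists_common_root`).

The line `y = 0` gives a common root of the two polynomials attached to `A` and `B` themselves. If
`r(A;c)` is irreducible, the vanishing resultant with respect to `t` forces it to divide `r(B;d)`,
and setting `x = 1`, `y = 0` gives divisibility of the one-variable polynomials (`cPoly_dvd_cPoly`).
-/

/-! ### Perturbation of ordered eigenvalues and continuity of the support value. -/

namespace LinearMap.IsSymmetric

variable {𝕜 E : Type*} [RCLike 𝕜] [NormedAddCommGroup E] [InnerProductSpace 𝕜 E]
  [FiniteDimensional 𝕜 E] {T S : E →ₗ[𝕜] E} {N : ℕ}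

/-- The quadratic form of a symmetric operator in coordinates of its eigenvector basis. -/
theorem re_inner_apply_self_eq_sum (hT : T.IsSymmetric) (hN : Module.finrank 𝕜 E = N) (x : E) :
    RCLike.re (inner 𝕜 (T x) x) =
      ∑ i, hT.eigenvalues hN i * ‖inner 𝕜 (hT.eigenvectorBasis hN i) x‖ ^ 2 := by
  rw [← (hT.eigenvectorBasis hN).sum_inner_mul_inner, map_sum]
  refine Finset.sum_congr rfl fun i _ => ?_
  rw [hT x, hT.apply_eigenvectorBasis, inner_smul_right, mul_assoc, ← inner_conj_symm x,
    RCLike.conj_mul, RCLike.re_ofReal_mul]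
  norm_cast

/-- Monotonicity of the ordered eigenvalues: if the quadratic form of `T` exceeds that of `S` by at
most `C` on the unit sphere, then each eigenvalue of `T` exceeds that of `S` by at most `C`. -/
theorem eigenvalues_le_add (hT : T.IsSymmetric) (hS : S.IsSymmetric)
    (hN : Module.finrank 𝕜 E = N) {C : ℝ}
    (h : ∀ x, RCLike.re (inner 𝕜 (T x) x) ≤ RCLike.re (inner 𝕜 (S x) x) + C * ‖x‖ ^ 2)
    (j : Fin N) : hT.eigenvalues hN j ≤ hS.eigenvalues hN j + C := by
  classical
  set v := hT.eigenvectorBasis hN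
  set w := hS.eigenvectorBasis hN
  -- These are `N - 1` linear conditions in dimension `N`, so some `x ≠ 0` is orthogonal to the `v
  -- i` with `i > j` and the `w i` with `i < j`. At `x` the Rayleigh quotient of `T` is at least its
  -- `j`-th eigenvalue, and that of `S` is at most its own.
  let φ : E →ₗ[𝕜] ({i : Fin N // i ≠ j} → 𝕜) := LinearMap.pi fun i =>
    if j < i.1 then innerₛₗ 𝕜 (v i.1) else innerₛₗ 𝕜 (w i.1)
  have hker : LinearMap.ker φ ≠ ⊥ := by
    apply LinearMap.ker_ne_bot_of_finrank_lt
    have : 0 < N := j.pos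
    simp [hN, Fintype.card_subtype_compl]
    omega
  obtain ⟨x, hx, hx0⟩ := (Submodule.ne_bot_iff _).1 hker
  have hv : ∀ i, j < i → inner 𝕜 (v i) x = 0 := fun i hi => by
    have := congrFun (LinearMap.mem_ker.1 hx) ⟨i, hi.ne'⟩
    simpa [φ, hi] using this
  have hw : ∀ i, i < j → inner 𝕜 (w i) x = 0 := fun i hi => by
    have := congrFun (LinearMap.mem_ker.1 hx) ⟨i, hi.ne⟩
    simpa [φ, hi.not_gt] using this
  have h1 : hT.eigenvalues hN j * ‖x‖ ^ 2 ≤ RCLike.re (inner 𝕜 (T x) x) := by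
    rw [hT.re_inner_apply_self_eq_sum hN, ← v.sum_sq_norm_inner_right x, Finset.mul_sum]
    refine Finset.sum_le_sum fun i _ => ?_
    rcases lt_or_ge j i with hi | hi
    · simp [v, hv i hi]
    · exact mul_le_mul_of_nonneg_right (hT.eigenvalues_antitone hN hi) (sq_nonneg _)
  have h2 : RCLike.re (inner 𝕜 (S x) x) ≤ hS.eigenvalues hN j * ‖x‖ ^ 2 := by
    rw [hS.re_inner_apply_self_eq_sum hN, ← w.sum_sq_norm_inner_right x, Finset.mul_sum]
    refine Finset.sum_le_sum fun i _ => ?_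
    rcases lt_or_ge i j with hi | hi
    · simp [w, hw i hi]
    · exact mul_le_mul_of_nonneg_right (hS.eigenvalues_antitone hN hi) (sq_nonneg _)
  have hpos : 0 < ‖x‖ ^ 2 := by positivity
  refine le_of_mul_le_mul_right ?_ hpos
  linarith [h x]

end LinearMap.IsSymmetric

namespace Matrix.IsHermitian

/-- Ordered eigenvalues of Hermitian matrices are Lipschitz in the operator norm. -/
theorem abs_eigenvalues₀_sub_le {ι : Type*} [Fintype ι] [DecidableEq ι] {A B : Matrix ι ι ℂ}
    (hA : A.IsHermitian) (hB : B.IsHermitian) (j : Fin (Fintype.card ι)) :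
    |hA.eigenvalues₀ j - hB.eigenvalues₀ j| ≤ ‖Matrix.toEuclideanCLM (𝕜 := ℂ) (A - B)‖ := by
  have key : ∀ {A B : Matrix ι ι ℂ} (hA : A.IsHermitian) (hB : B.IsHermitian),
      hA.eigenvalues₀ j ≤ hB.eigenvalues₀ j + ‖Matrix.toEuclideanCLM (𝕜 := ℂ) (A - B)‖ := by
    intro A B hA hB
    refine LinearMap.IsSymmetric.eigenvalues_le_add _ _ _ (fun x => ?_) j
    have h1 : RCLike.re (inner ℂ (Matrix.toEuclideanCLM (𝕜 := ℂ) (A - B) x) x) ≤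
        ‖Matrix.toEuclideanCLM (𝕜 := ℂ) (A - B)‖ * ‖x‖ ^ 2 := by
      refine (re_inner_le_norm _ _).trans ?_
      rw [sq, ← mul_assoc]
      exact mul_le_mul_of_nonneg_right (ContinuousLinearMap.le_opNorm _ _) (norm_nonneg _)
    rw [map_sub, _root_.sub_apply, inner_sub_left, map_sub] at h1
    rw [map_sub]
    exact sub_le_iff_le_add'.1 h1
  rw [abs_sub_le_iff]
  refine ⟨sub_le_iff_le_add'.2 (key hA hB), sub_le_iff_le_add'.2 ?_⟩
  have := key hB hA
  rwa [← neg_sub A B, map_neg, norm_neg] at this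

end Matrix.IsHermitian

namespace WeightedNR

theorem continuous_rotHerm {n : ℕ} (A : Matrix (Fin n) (Fin n) ℂ) : Continuous (rotHerm A) := by
  unfold rotHerm
  fun_prop

theorem continuous_sortedEig {n : ℕ} (A : Matrix (Fin n) (Fin n) ℂ) (j : Fin n) :
    Continuous fun θ => sortedEig A θ j := by
  have hc : Continuous fun M : Matrix (Fin n) (Fin n) ℂ => Matrix.toEuclideanCLM (𝕜 := ℂ) M :=
    LinearMap.continuous_of_finiteDimensional
      (Matrix.toEuclideanCLM (n := Fin n) (𝕜 := ℂ)).toAlgEquiv.toLinearMap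
  refine continuous_iff_continuousAt.2 fun θ₀ => tendsto_iff_dist_tendsto_zero.2 ?_
  refine squeeze_zero (fun _ => dist_nonneg) (fun θ =>
    (rotHerm_isHermitian A θ).abs_eigenvalues₀_sub_le (rotHerm_isHermitian A θ₀) _) ?_
  have : Continuous fun θ => ‖Matrix.toEuclideanCLM (𝕜 := ℂ) (rotHerm A θ - rotHerm A θ₀)‖ :=
    (hc.comp ((continuous_rotHerm A).sub continuous_const)).norm
  simpa using this.tendsto θ₀

theorem continuous_supportValue {n : ℕ} (A : Matrix (Fin n) (Fin n) ℂ) (c : Fin n → ℝ) :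
    Continuous (supportValue A c) :=
  continuous_finsetSum _ fun j _ => continuous_const.mul (continuous_sortedEig A j)

/-- Makes the support value a function on the unit circle, so that angles may be moved into `[-π,
π]` and paths of directions may end at any representative of an angle. -/
theorem supportValue_congr {n : ℕ} (A : Matrix (Fin n) (Fin n) ℂ) (c : Fin n → ℝ) {θ θ' : ℝ}
    (h : Complex.exp (θ * Complex.I) = Complex.exp (θ' * Complex.I)) :
    supportValue A c θ = supportValue A c θ' := by
  have hr : rotHerm A θ = rotHerm A θ' := by
    unfold rotHerm
    rw [Complex.exp_neg, Complex.exp_neg, h]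
  unfold supportValue sortedEig
  simp only [hr]

end WeightedNR

/-! ### Convex geometry: boundary points and common support lines. -/

namespace WeightedNR

section Geometry

variable {n m : ℕ} {A : Matrix (Fin n) (Fin n) ℂ} {B : Matrix (Fin m) (Fin m) ℂ}
  {c : Fin n → ℝ} {d : Fin m → ℝ}

theorem mem_weightedRange {v : ℂ} :
    v ∈ weightedRange A c ↔ ∀ θ : ℝ, (Complex.exp (θ * Complex.I) * v).re ≤ supportValue A c θ := by
  simp [weightedRange]

theorem isClosed_weightedRange : IsClosed (weightedRange A c) :=
  isClosed_iInter fun _ => isClosed_le (by fun_prop) continuous_const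

theorem convex_weightedRange : Convex ℝ (weightedRange A c) := by
  intro x hx y hy a b ha hb hab
  rw [mem_weightedRange] at *
  intro θ
  have h : (Complex.exp (θ * Complex.I) * (a • x + b • y)).re =
      a * (Complex.exp (θ * Complex.I) * x).re + b * (Complex.exp (θ * Complex.I) * y).re := by
    simp; ring
  rw [h, ← one_mul (supportValue A c θ), ← hab, add_mul]
  exact add_le_add (mul_le_mul_of_nonneg_left (hx θ) ha) (mul_le_mul_of_nonneg_left (hy θ) hb)

/-- A boundary point lies on one of the defining lines. -/
theorem exists_eq_supportValue_of_mem_frontier {z : ℂ} (hz : z ∈ frontier (weightedRange A c)) :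
    ∃ θ : ℝ, (Complex.exp (θ * Complex.I) * z).re = supportValue A c θ := by
  have hzW : z ∈ weightedRange A c := isClosed_weightedRange.frontier_subset hz
  by_contra! hne
  have hpos : ∀ θ : ℝ, 0 < supportValue A c θ - (Complex.exp (θ * Complex.I) * z).re := fun θ =>
    sub_pos.2 (lt_of_le_of_ne (mem_weightedRange.1 hzW θ) (hne θ))
  -- By compactness of one period the slack has a positive minimum `ε`, and then the ball of radius
  -- `ε` about `z` satisfies every constraint.
  have hcont : Continuous fun θ : ℝ =>
      supportValue A c θ - (Complex.exp (θ * Complex.I) * z).re :=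
    (continuous_supportValue A c).sub (by fun_prop)
  obtain ⟨θ₀, -, hθ₀⟩ := (isCompact_Icc (a := -Real.pi) (b := Real.pi)).exists_isMinOn
    ⟨0, by simp [Real.pi_pos.le]⟩ hcont.continuousOn
  set ε := supportValue A c θ₀ - (Complex.exp (θ₀ * Complex.I) * z).re with hε
  refine hz.2 (mem_interior.2 ⟨Metric.ball z ε, fun v hv => mem_weightedRange.2 fun θ => ?_,
    Metric.isOpen_ball, Metric.mem_ball_self (hpos θ₀)⟩)
  set φ := (Complex.exp (θ * Complex.I)).arg
  have hφ : Complex.exp (φ * Complex.I) = Complex.exp (θ * Complex.I) := by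
    have := Complex.norm_mul_exp_arg_mul_I (Complex.exp (θ * Complex.I))
    rwa [Complex.norm_exp_ofReal_mul_I, Complex.ofReal_one, one_mul] at this
  have hmin : ε ≤ supportValue A c φ - (Complex.exp (φ * Complex.I) * z).re :=
    isMinOn_iff.1 hθ₀ φ ⟨(Complex.neg_pi_lt_arg _).le, Complex.arg_le_pi _⟩
  rw [hφ, supportValue_congr A c hφ] at hmin
  have hle : (Complex.exp (θ * Complex.I) * (v - z)).re ≤ ε := by
    refine (Complex.re_le_norm _).trans ?_
    rw [norm_mul, Complex.norm_exp_ofReal_mul_I, one_mul]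
    exact (mem_ball_iff_norm.1 hv).le
  rw [mul_sub, Complex.sub_re] at hle
  linarith

/-- A point of the weighted range on one of the defining lines is a boundary point. -/
theorem mem_frontier_of_eq_supportValue {v : ℂ} (hv : v ∈ weightedRange A c) {θ : ℝ}
    (h : (Complex.exp (θ * Complex.I) * v).re = supportValue A c θ) :
    v ∈ frontier (weightedRange A c) := by
  refine ⟨subset_closure hv, fun hi => ?_⟩
  obtain ⟨ε, hε, hball⟩ := Metric.isOpen_iff.1 isOpen_interior v hi
  set u := Complex.exp (-(θ * Complex.I))
  have hu : ‖u‖ = 1 := by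
    rw [show u = Complex.exp (((-θ : ℝ) : ℂ) * Complex.I) by simp [u]]
    exact Complex.norm_exp_ofReal_mul_I _
  -- Since `e^{iθ}u = 1`, this outward push violates the constraint in direction `θ`, which is
  -- already an equality at `v`.
  have hmem : v + (ε / 2 : ℝ) • u ∈ weightedRange A c := by
    refine interior_subset (hball (mem_ball_iff_norm.2 ?_))
    rw [add_sub_cancel_left, norm_smul, hu, Real.norm_of_nonneg (by positivity)]
    linarith
  have h1 := mem_weightedRange.1 hmem θ
  rw [mul_add, mul_smul_comm, ← Complex.exp_add, add_neg_cancel, Complex.exp_zero, Complex.add_re,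
    h] at h1
  simp at h1
  linarith

theorem segment_subset_frontier {z w : ℂ} (hz : z ∈ weightedRange A c)
    (hw : w ∈ weightedRange A c) {θ : ℝ}
    (h : (Complex.exp (θ * Complex.I) * z).re = supportValue A c θ)
    (h' : (Complex.exp (θ * Complex.I) * (z - w)).re = 0) :
    segment ℝ z w ⊆ frontier (weightedRange A c) := by
  intro v hv
  refine mem_frontier_of_eq_supportValue (θ := θ) (convex_weightedRange.segment_subset hz hw hv) ?_
  obtain ⟨a, b, -, -, hab, rfl⟩ := hv
  rw [mul_sub, Complex.sub_re, sub_eq_zero] at h'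
  have : (Complex.exp (θ * Complex.I) * (a • z + b • w)).re =
      a * (Complex.exp (θ * Complex.I) * z).re + b * (Complex.exp (θ * Complex.I) * w).re := by
    simp; ring
  rw [this, ← h', h, ← add_mul, hab, one_mul]

/-- A continuous path of directions from `e^{iα}` to `e^{iβ}` along the shorter arc. If `g` changes
sign between the ends, it vanishes in a direction that is a positive combination of both. -/
theorem exists_zero_between {g : ℝ → ℝ} (hg : Continuous g)
    (hper : ∀ θ θ' : ℝ, Complex.exp (θ * Complex.I) = Complex.exp (θ' * Complex.I) → g θ = g θ')
    {α β : ℝ} (hα : g α < 0) (hβ : 0 < g β)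
    (hne : Complex.exp (β * Complex.I) ≠ -Complex.exp (α * Complex.I)) :
    ∃ θ a b : ℝ, 0 < a ∧ 0 < b ∧ g θ = 0 ∧ Complex.exp (θ * Complex.I) =
      a * Complex.exp (α * Complex.I) + b * Complex.exp (β * Complex.I) := by
  set e := Complex.exp (((β - α : ℝ) : ℂ) * Complex.I) with he
  have hαe : Complex.exp (α * Complex.I) * e = Complex.exp (β * Complex.I) := by
    rw [he, ← Complex.exp_add]; congr 1; push_cast; ring
  have he1 : e ≠ -1 := fun h => hne (by rw [← hαe, h]; ring)
  -- The chord from `1` to `e` meets the negative real axis or `0` only if `e = -1`; otherwise the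
  -- argument is continuous along it.
  let q : ℝ → ℂ := fun τ => (1 - τ : ℝ) + (τ : ℝ) * e
  have hq : ∀ τ, q τ ∈ Complex.slitPlane := by
    intro τ
    rw [Complex.mem_slitPlane_iff]
    by_cases him : (q τ).im = 0
    · left
      have h1 : τ * e.im = 0 := by simpa [q] using him
      rcases mul_eq_zero.1 h1 with h0 | h0
      · simp [q, h0]
      · have hn : e.re ^ 2 + e.im ^ 2 = 1 := by
          have := Complex.sq_norm e
          rw [he, Complex.norm_exp_ofReal_mul_I, Complex.normSq_apply, ← he] at this
          linarith
        have h2 : (e.re - 1) * (e.re + 1) = 0 := by rw [h0] at hn; linarith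
        rcases mul_eq_zero.1 h2 with h3 | h3
        · have h4 : e.re = 1 := by linarith
          simp [q, h4]
        · exact absurd (Complex.ext (by simpa using by linarith) (by simpa using h0)) he1
    · exact Or.inr him
  have hqc : Continuous q := by fun_prop
  let p : ℝ → ℝ := fun τ => α + (q τ).arg
  have hp : Continuous p := continuous_const.add
    (continuous_iff_continuousAt.2 fun τ => (Complex.continuousAt_arg (hq τ)).comp hqc.continuousAt)
  have hp0 : p 0 = α := by simp [p, q]
  have hpexp : ∀ τ, (‖q τ‖ : ℂ) * Complex.exp (p τ * Complex.I) =
      (1 - τ : ℝ) * Complex.exp (α * Complex.I) + (τ : ℝ) * Complex.exp (β * Complex.I) := by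
    intro τ
    have h1 := Complex.norm_mul_exp_arg_mul_I (q τ)
    rw [← hαe]
    simp only [p, Complex.ofReal_add, add_mul, Complex.exp_add]
    rw [mul_left_comm, h1]
    simp only [q]
    ring
  have hp1 : g (p 1) = g β := by
    refine hper _ _ ?_
    have h1 : ‖q 1‖ = 1 := by simp [q, he, Complex.norm_exp_ofReal_mul_I, -Complex.ofReal_sub]
    simpa [h1] using hpexp 1
  obtain ⟨τ, hτ, hgτ⟩ := intermediate_value_Ioo (zero_le_one' ℝ) (hg.comp hp).continuousOn
    (show (0 : ℝ) ∈ Set.Ioo ((g ∘ p) 0) ((g ∘ p) 1) by simp [hp0, hp1, hα, hβ])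
  have hpos : 0 < ‖q τ‖ := norm_pos_iff.2 (Complex.slitPlane_ne_zero (hq τ))
  refine ⟨p τ, (1 - τ) / ‖q τ‖, τ / ‖q τ‖, div_pos (by linarith [hτ.2]) hpos,
    div_pos hτ.1 hpos, hgτ, ?_⟩
  have h2 : (‖q τ‖ : ℂ) ≠ 0 := by exact_mod_cast hpos.ne'
  apply mul_left_cancel₀ h2
  rw [hpexp]
  push_cast
  field_simp

/-- Common boundary points, no two of which bound a common boundary segment, give rise to common
support lines, each of which separates its point strictly from the other points. -/
theorem exists_common_supportValue {ι : Type*} [Nontrivial ι] {z : ι → ℂ}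
    (hz : ∀ r, z r ∈ frontier (weightedRange A c) ∩ frontier (weightedRange B d))
    (hseg : ∀ r s, r ≠ s → ¬ segment ℝ (z r) (z s) ⊆
      frontier (weightedRange A c) ∩ frontier (weightedRange B d)) (r : ι) :
    ∃ θ : ℝ, supportValue A c θ = supportValue B d θ ∧
      ∀ s, s ≠ r → 0 < (Complex.exp (θ * Complex.I) * (z r - z s)).re := by
  have hA : ∀ s, z s ∈ weightedRange A c := fun s =>
    isClosed_weightedRange.frontier_subset (hz s).1
  have hB : ∀ s, z s ∈ weightedRange B d := fun s =>
    isClosed_weightedRange.frontier_subset (hz s).2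
  obtain ⟨α, hα⟩ := exists_eq_supportValue_of_mem_frontier (hz r).1
  obtain ⟨β, hβ⟩ := exists_eq_supportValue_of_mem_frontier (hz r).2
  have hα0 : ∀ s, 0 ≤ (Complex.exp (α * Complex.I) * (z r - z s)).re := fun s => by
    rw [mul_sub, Complex.sub_re, hα]
    exact sub_nonneg.2 (mem_weightedRange.1 (hA s) α)
  have hβ0 : ∀ s, 0 ≤ (Complex.exp (β * Complex.I) * (z r - z s)).re := fun s => by
    rw [mul_sub, Complex.sub_re, hβ]
    exact sub_nonneg.2 (mem_weightedRange.1 (hB s) β)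
  -- If `z s` lies on a support line of each range through `z r`, the whole segment lies in both
  -- boundaries, which is excluded.
  have hno : ∀ s, s ≠ r → ∀ φ ψ : ℝ,
      (Complex.exp (φ * Complex.I) * z r).re = supportValue A c φ →
      (Complex.exp (ψ * Complex.I) * z r).re = supportValue B d ψ →
      (Complex.exp (φ * Complex.I) * (z r - z s)).re = 0 →
      (Complex.exp (ψ * Complex.I) * (z r - z s)).re = 0 → False :=
    fun s hs φ ψ h1 h2 h3 h4 => hseg r s hs.symm (Set.subset_inter
      (segment_subset_frontier (hA r) (hA s) h1 h3) (segment_subset_frontier (hB r) (hB s) h2 h4))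
  -- The difference of the support values is nonpositive at `α` and nonnegative at `β`, so a zero is
  -- sought at or between these directions.
  have hgα : supportValue A c α ≤ supportValue B d α := hα ▸ mem_weightedRange.1 (hB r) α
  have hgβ : supportValue B d β ≤ supportValue A c β := hβ ▸ mem_weightedRange.1 (hA r) β
  rcases hgα.eq_or_lt with hgα | hgα
  · exact ⟨α, hgα, fun s hs => lt_of_le_of_ne (hα0 s) fun h =>
      hno s hs α α hα (hα.trans hgα) h.symm h.symm⟩
  rcases hgβ.eq_or_lt with hgβ | hgβ
  · exact ⟨β, hgβ.symm, fun s hs => lt_of_le_of_ne (hβ0 s) fun h =>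
      hno s hs β β (hβ.trans hgβ) hβ h.symm h.symm⟩
  -- For opposite directions the two half-planes confine every `z s` to one line, so a single
  -- further point contradicts `hno`.
  by_cases hopp : Complex.exp (β * Complex.I) = -Complex.exp (α * Complex.I)
  · obtain ⟨s, hs⟩ := exists_ne r
    have h1 := hβ0 s
    rw [hopp, neg_mul, Complex.neg_re] at h1
    have h2 := le_antisymm (neg_nonneg.1 h1) (hα0 s)
    refine (hno s hs α β hα hβ h2 ?_).elim
    rw [hopp, neg_mul, Complex.neg_re, h2, neg_zero]
  obtain ⟨θ, a, b, ha, hb, hθ, hexp⟩ := exists_zero_between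
    ((continuous_supportValue A c).sub (continuous_supportValue B d))
    (fun θ θ' h => congrArg₂ (· - ·) (supportValue_congr A c h) (supportValue_congr B d h))
    (sub_neg.2 hgα) (sub_pos.2 hgβ) hopp
  refine ⟨θ, sub_eq_zero.1 hθ, fun s hs => ?_⟩
  have hre : (Complex.exp (θ * Complex.I) * (z r - z s)).re =
      a * (Complex.exp (α * Complex.I) * (z r - z s)).re +
        b * (Complex.exp (β * Complex.I) * (z r - z s)).re := by
    rw [hexp, add_mul, mul_assoc, mul_assoc, Complex.add_re, Complex.re_ofReal_mul,
      Complex.re_ofReal_mul]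
  rw [hre]
  rcases (hα0 s).eq_or_lt with h1 | h1
  · rcases (hβ0 s).eq_or_lt with h2 | h2
    · exact (hno s hs α β hα hβ h1.symm h2.symm).elim
    · exact add_pos_of_nonneg_of_pos (mul_nonneg ha.le (hα0 s)) (mul_pos hb h2)
  · exact add_pos_of_pos_of_nonneg (mul_pos ha h1) (mul_nonneg hb.le (hβ0 s))

/-- Directions that strictly separate distinct points of the weighted range give distinct points
`(y / x, t / x)` on the dual curve, where `x = e^{iθ} / 2`, `y = e^{-iθ} / 2` and `t` is the support
value. -/
theorem eq_of_dual_point_eq {z w : ℂ} (hz : z ∈ weightedRange A c) (hw : w ∈ weightedRange A c)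
    {θ φ : ℝ} (hθ : 0 < (Complex.exp (θ * Complex.I) * (z - w)).re)
    (hφ : 0 < (Complex.exp (φ * Complex.I) * (w - z)).re)
    (h1 : Complex.exp (-(θ * Complex.I)) ^ 2 = Complex.exp (-(φ * Complex.I)) ^ 2)
    (h2 : (supportValue A c θ : ℂ) * Complex.exp (-(θ * Complex.I)) =
      supportValue A c φ * Complex.exp (-(φ * Complex.I))) : False := by
  rw [mul_sub, Complex.sub_re] at hθ hφ
  rcases sq_eq_sq_iff_eq_or_eq_neg.1 h1 with h | h
  · rw [Complex.exp_neg, Complex.exp_neg, inv_inj] at h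
    rw [h] at hθ
    linarith
  -- Opposite directions with opposite support values squeeze the range into a line, on which no
  -- strict separation is possible.
  · have h3 : Complex.exp (θ * Complex.I) = -Complex.exp (φ * Complex.I) := by
      rw [Complex.exp_neg, Complex.exp_neg, ← inv_neg, inv_inj] at h
      exact h
    have h4 : supportValue A c φ = -supportValue A c θ := by
      rw [h, mul_neg, ← neg_mul] at h2
      have := mul_right_cancel₀ (Complex.exp_ne_zero _) h2
      exact_mod_cast this.symm
    have hz1 := mem_weightedRange.1 hz φ
    have hw1 := mem_weightedRange.1 hw θ
    have hz2 := mem_weightedRange.1 hz θ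
    have hw2 := mem_weightedRange.1 hw φ
    rw [h3, neg_mul, Complex.neg_re] at *
    linarith

end Geometry

end WeightedNR

/-! ### Degree of the resultant and a weak Bézout theorem. -/

open Polynomial in
/-- If the degrees of the entries of a matrix of polynomials are bounded by `u j - v i`, then the
degree of the determinant is bounded by `∑ u - ∑ v`. -/
theorem Matrix.natDegree_det_add_sum_le {R ι : Type*} [CommRing R] [Fintype ι] [DecidableEq ι]
    (M : Matrix ι ι R[X]) (u v : ι → ℕ)
    (h : ∀ i j, M i j ≠ 0 → (M i j).natDegree + v i ≤ u j) (hM : M.det ≠ 0) :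
    M.det.natDegree + ∑ i, v i ≤ ∑ i, u i := by
  have hcoeff : ∀ k, ∑ i, u i < k + ∑ i, v i → M.det.coeff k = 0 := by
    intro k hk
    rw [Matrix.det_apply, finsetSum_coeff]
    refine Finset.sum_eq_zero fun σ _ => ?_
    rw [coeff_smul]
    by_cases hz : ∀ i, M (σ i) i ≠ 0
    · have h1 : ∑ i, (M (σ i) i).natDegree + ∑ i, v (σ i) ≤ ∑ i, u i := by
        rw [← Finset.sum_add_distrib]
        exact Finset.sum_le_sum fun i _ => h _ _ (hz i)
      rw [Equiv.sum_comp σ v] at h1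
      have h2 : (∏ i, M (σ i) i).natDegree ≤ ∑ i, (M (σ i) i).natDegree := natDegree_prod_le _ _
      have h3 : (∏ i, M (σ i) i).coeff k = 0 := coeff_eq_zero_of_natDegree_lt (by omega)
      exact (congrArg _ h3).trans (smul_zero _)
    · push Not at hz
      obtain ⟨i, hi⟩ := hz
      have h3 : (∏ i, M (σ i) i).coeff k = 0 := by
        rw [show (∏ i, M (σ i) i) = 0 from Finset.prod_eq_zero (Finset.mem_univ i) hi, coeff_zero]
      exact (congrArg _ h3).trans (smul_zero _)
  by_contra! hlt
  exact hM (leadingCoeff_eq_zero.1 (hcoeff _ hlt))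

namespace Polynomial

/-- A polynomial in two variables has total degree at most `D`. -/
def BivariateDegreeLE {R : Type*} [Semiring R] (D : ℕ) (p : R[X][X]) : Prop :=
  ∀ m k, D < k + m → (p.coeff m).coeff k = 0

namespace BivariateDegreeLE

variable {R : Type*} [CommRing R] {D E : ℕ} {p q : R[X][X]}

theorem natDegree_le (hp : BivariateDegreeLE D p) : p.natDegree ≤ D :=
  natDegree_le_iff_coeff_eq_zero.2 fun m hm => Polynomial.ext fun k => by
    rw [hp m k (by omega), coeff_zero]

theorem natDegree_coeff_add_le (hp : BivariateDegreeLE D p) {m : ℕ} (h : p.coeff m ≠ 0) :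
    (p.coeff m).natDegree + m ≤ D := by
  by_contra! hlt
  exact h (leadingCoeff_eq_zero.1 (hp m _ hlt))

theorem mono (hp : BivariateDegreeLE D p) (h : D ≤ E) : BivariateDegreeLE E p :=
  fun m k hk => hp m k (h.trans_lt hk)

theorem mul (hp : BivariateDegreeLE D p) (hq : BivariateDegreeLE E q) :
    BivariateDegreeLE (D + E) (p * q) := by
  intro m k hk
  rw [coeff_mul, finsetSum_coeff]
  refine Finset.sum_eq_zero fun x hx => ?_
  rw [coeff_mul]
  refine Finset.sum_eq_zero fun y hy => ?_
  rw [Finset.HasAntidiagonal.mem_antidiagonal] at hx hy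
  rcases lt_or_ge D (y.1 + x.1) with h | h
  · rw [hp _ _ h, zero_mul]
  · rw [hq x.2 y.2 (by omega), mul_zero]

theorem one : BivariateDegreeLE 0 (1 : R[X][X]) := by
  intro m k hk
  rw [coeff_one]
  split_ifs with h
  · rw [coeff_one, if_neg (by omega)]
  · rw [coeff_zero]

theorem pow (hp : BivariateDegreeLE D p) (n : ℕ) : BivariateDegreeLE (n * D) (p ^ n) := by
  induction n with
  | zero => simpa using one
  | succ n ih => rw [pow_succ, add_mul, one_mul]; exact ih.mul hp

theorem prod {ι : Type*} (s : Finset ι) {D : ι → ℕ} {p : ι → R[X][X]}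
    (h : ∀ i ∈ s, BivariateDegreeLE (D i) (p i)) :
    BivariateDegreeLE (∑ i ∈ s, D i) (∏ i ∈ s, p i) := by
  classical
  induction s using Finset.induction_on with
  | empty => simpa using one
  | insert i s hi ih =>
    rw [Finset.sum_insert hi, Finset.prod_insert hi]
    exact (h i (Finset.mem_insert_self i s)).mul
      (ih fun j hj => h j (Finset.mem_insert_of_mem hj))

theorem sum {ι : Type*} (s : Finset ι) {p : ι → R[X][X]}
    (h : ∀ i ∈ s, BivariateDegreeLE D (p i)) : BivariateDegreeLE D (∑ i ∈ s, p i) := by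
  intro m k hk
  rw [finsetSum_coeff, finsetSum_coeff]
  exact Finset.sum_eq_zero fun i hi => h i hi m k hk

theorem C_C (r : R) : BivariateDegreeLE 0 (C (C r) : R[X][X]) := by
  intro m k hk
  rw [coeff_C]
  split_ifs with h
  · rw [coeff_C, if_neg (by omega)]
  · rw [coeff_zero]

theorem add (hp : BivariateDegreeLE D p) (hq : BivariateDegreeLE D q) :
    BivariateDegreeLE D (p + q) := fun m k hk => by
  rw [coeff_add, coeff_add, hp m k hk, hq m k hk, add_zero]

theorem X : BivariateDegreeLE 1 (X : R[X][X]) := by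
  intro m k hk
  rw [coeff_X]
  split_ifs with h
  · rw [coeff_one, if_neg (by omega)]
  · rw [coeff_zero]

theorem C_X : BivariateDegreeLE 1 (C Polynomial.X : R[X][X]) := by
  intro m k hk
  rw [coeff_C]
  split_ifs with h
  · rw [coeff_X, if_neg (by omega)]
  · rw [coeff_zero]

/-- Substituting polynomials of degree at most one does not raise the total degree. -/
theorem eval₂ {K σ : Type*} [Fintype σ] [CommRing K] {f : MvPolynomial σ K}
    (hf : f.totalDegree ≤ D) (φ : K →+* R) {v : σ → R[X][X]}
    (hv : ∀ i, BivariateDegreeLE 1 (v i)) :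
    BivariateDegreeLE D (MvPolynomial.eval₂ ((C.comp C).comp φ) v f) := by
  rw [MvPolynomial.eval₂_eq']
  refine sum _ fun e he => ((C_C (φ (f.coeff e))).mul
    (prod Finset.univ fun i _ => (hv i).pow (e i))).mono ?_
  have := MvPolynomial.le_totalDegree he
  rw [Finsupp.sum_fintype _ _ fun _ => rfl] at this
  simpa using this.trans hf

/-- The degree bound of Bézout's theorem. -/
theorem natDegree_resultant_le (hp : BivariateDegreeLE D p) (hq : BivariateDegreeLE E q) :
    (resultant p q D E).natDegree ≤ D * E := by
  by_cases h0 : resultant p q D E = 0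
  · simp [h0]
  -- Row `i` gets weight `i`, and a column holding shifted coefficients of `q` or `p` gets its shift
  -- plus `E` or `D`. The column weights exceed the row weights by `2DE - DE = DE` in total.
  have h := Matrix.natDegree_det_add_sum_le (sylvester p q D E)
    (fun j => j.addCases (fun j₁ => E + (j₁ : ℕ)) fun j₁ => D + (j₁ : ℕ)) (fun i => (i : ℕ))
    (by
      intro i j hij
      induction j using Fin.addCases with
      | left j₁ =>
        simp only [sylvester, Matrix.of_apply, Fin.addCases_left, Set.mem_Icc, ne_eq,
          ite_eq_right_iff, Classical.not_imp] at hij ⊢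
        rw [if_pos hij.1]
        have := hq.natDegree_coeff_add_le hij.2
        omega
      | right j₁ =>
        simp only [sylvester, Matrix.of_apply, Fin.addCases_right, Set.mem_Icc, ne_eq,
          ite_eq_right_iff, Classical.not_imp] at hij ⊢
        rw [if_pos hij.1]
        have := hp.natDegree_coeff_add_le hij.2
        omega) h0
  rw [Fin.sum_univ_add, Fin.sum_univ_add] at h
  simp only [Fin.addCases_left, Fin.addCases_right, Finset.sum_add_distrib, Fin.val_castAdd,
    Fin.val_natAdd, Finset.sum_const, Finset.card_univ, Fintype.card_fin, smul_eq_mul] at h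
  change (resultant p q D E).natDegree + _ ≤ _ at h
  rw [mul_comm E D] at h
  omega

end BivariateDegreeLE

end Polynomial

namespace MvPolynomial

open Polynomial (resultant evalRingHom eval₂RingHom)

/-- The restriction of a polynomial in three variables to the line `{(1, y + a t, t)}`. -/
noncomputable def restrictLine {K S : Type*} [CommRing K] [CommRing S] (φ : K →+* S) (y a : S)
    (f : MvPolynomial (Fin 3) K) : Polynomial S :=
  f.eval₂ (Polynomial.C.comp φ) ![1, Polynomial.C y + Polynomial.C a * Polynomial.X, Polynomial.X]

theorem map_restrictLine {K S S' : Type*} [CommRing K] [CommRing S] [CommRing S'] (φ : K →+* S)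
    (ψ : S →+* S') (y a : S) (f : MvPolynomial (Fin 3) K) :
    (restrictLine φ y a f).map ψ = restrictLine (ψ.comp φ) (ψ y) (ψ a) f := by
  unfold restrictLine
  rw [← Polynomial.coe_mapRingHom, MvPolynomial.hom_eval₂]
  congr 1
  · ext; simp
  · funext i; fin_cases i <;> simp

theorem eval_restrictLine {K S : Type*} [CommRing K] [CommRing S] (φ : K →+* S) (y a t : S)
    (f : MvPolynomial (Fin 3) K) :
    (restrictLine φ y a f).eval t = f.eval₂ φ ![1, y + a * t, t] := by
  unfold restrictLine
  rw [← Polynomial.coe_evalRingHom, MvPolynomial.hom_eval₂]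
  congr 1
  · ext; simp
  · funext i; fin_cases i <;> simp

/-- The weak form of Bézout's theorem: if two plane curves of degrees at most `D` and `E` have more
than `D * E` common points, then they have a common point on every line through a given point
(expressed by the vanishing of the resultant). -/
theorem resultant_restrictLine_eq_zero {K : Type*} [Field K] {ι : Type*} [Fintype ι]
    {f g : MvPolynomial (Fin 3) K} {D E : ℕ} (hf : f.totalDegree ≤ D) (hg : g.totalDegree ≤ E)
    (hDE : D ≠ 0 ∨ E ≠ 0) {p q : ι → K} (hpq : ∀ r s, p r = p s → q r = q s → r = s)
    (hcard : D * E < Fintype.card ι) (hfz : ∀ r, eval ![1, p r, q r] f = 0)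
    (hgz : ∀ r, eval ![1, p r, q r] g = 0) (y : K) :
    resultant (restrictLine (RingHom.id K) y 0 f) (restrictLine (RingHom.id K) y 0 g) D E = 0 := by
  -- The inner variable is a generic slope `a`, the outer one is `y`. Distinct common points may
  -- share a first coordinate; the shear `y + a t` gives them distinct values `y = p r - a q r` in
  -- `K[a]`.
  let φ : K →+* Polynomial (Polynomial K) := Polynomial.C.comp Polynomial.C
  let F := restrictLine φ Polynomial.X (Polynomial.C Polynomial.X) f
  let G := restrictLine φ Polynomial.X (Polynomial.C Polynomial.X) g
  have hv : ∀ i, Polynomial.BivariateDegreeLE 1 ((![1, Polynomial.C Polynomial.X +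
      Polynomial.C (Polynomial.C Polynomial.X) * Polynomial.X, Polynomial.X] :
        Fin 3 → Polynomial (Polynomial (Polynomial K))) i) := by
    intro i
    fin_cases i
    · exact Polynomial.BivariateDegreeLE.one.mono zero_le_one
    · exact Polynomial.BivariateDegreeLE.C_X.add
        ((Polynomial.BivariateDegreeLE.C_C (Polynomial.X : Polynomial K)).mul
          Polynomial.BivariateDegreeLE.X)
    · exact Polynomial.BivariateDegreeLE.X
  have hF : Polynomial.BivariateDegreeLE D F :=
    Polynomial.BivariateDegreeLE.eval₂ hf Polynomial.C hv
  have hG : Polynomial.BivariateDegreeLE E G :=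
    Polynomial.BivariateDegreeLE.eval₂ hg Polynomial.C hv
  have hres : resultant F G D E = 0 := by
    let Y : ι → Polynomial K := fun r =>
      Polynomial.C (p r) - Polynomial.C (q r) * Polynomial.X
    have hY : Function.Injective Y := by
      intro r s h
      have h0 := congrArg (Polynomial.coeff · 0) h
      have h1 := congrArg (Polynomial.coeff · 1) h
      simp [Y, Polynomial.coeff_C] at h0 h1
      exact hpq r s h0 h1
    refine Polynomial.eq_zero_of_natDegree_lt_card_of_eval_eq_zero _ hY (fun r => ?_)
      ((hF.natDegree_resultant_le hG).trans_lt hcard)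
    have hroot : ∀ h : MvPolynomial (Fin 3) K, eval ![1, p r, q r] h = 0 →
        ((restrictLine φ Polynomial.X (Polynomial.C Polynomial.X) h).map
          (evalRingHom (Y r))).eval (Polynomial.C (q r)) = 0 := by
      intro h hh
      rw [map_restrictLine, eval_restrictLine]
      have : eval₂ ((evalRingHom (Y r)).comp φ) ![1, evalRingHom (Y r) Polynomial.X +
          evalRingHom (Y r) (Polynomial.C Polynomial.X) * Polynomial.C (q r), Polynomial.C (q r)] h
          = Polynomial.C (eval ![1, p r, q r] h) := by
        rw [← MvPolynomial.eval₂_id, MvPolynomial.hom_eval₂]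
        congr 1
        · ext; simp [φ]
        · funext i
          fin_cases i
          · simp
          · simp [Y]
          · simp
      rw [this, hh, Polynomial.C_0]
    -- The resultant is a combination of `F` and `G`, so it vanishes at each `Y r`, where they share
    -- the root `q r`.
    obtain ⟨a, b, -, -, hab⟩ := Polynomial.exists_mul_add_mul_eq_C_resultant F G hF.natDegree_le
      hG.natDegree_le hDE
    have h1 := congrArg (fun P => (P.map (evalRingHom (Y r))).eval (Polynomial.C (q r))) hab
    simp only [Polynomial.map_add, Polynomial.map_mul, Polynomial.eval_add, Polynomial.eval_mul,
      Polynomial.map_C, Polynomial.eval_C] at h1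
    rw [hroot f (hfz r), hroot g (hgz r), zero_mul, zero_mul, add_zero] at h1
    simpa using h1.symm
  -- Undoes the shear by `a = 0` and fixes the line.
  let ψ : Polynomial (Polynomial K) →+* K := eval₂RingHom (evalRingHom 0) y
  have hψ : ∀ h : MvPolynomial (Fin 3) K,
      (restrictLine φ Polynomial.X (Polynomial.C Polynomial.X) h).map ψ =
        restrictLine (RingHom.id K) y 0 h := by
    intro h
    rw [map_restrictLine]
    congr 1
    · ext; simp [ψ, φ]
    · simp [ψ]
    · simp [ψ]
  rw [← hψ f, ← hψ g, Polynomial.resultant_map_map]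
  exact (congrArg ψ hres).trans (map_zero ψ)

end MvPolynomial

/-! ### Auxiliary algebra: permutations, common roots, divisibility, homogeneity. -/

/-- Two families with the same multiset of values agree up to a permutation of the indices. -/
theorem Multiset.exists_perm_of_map_univ_eq {ι α : Type*} [Fintype ι] {x y : ι → α}
    (h : Finset.univ.val.map x = Finset.univ.val.map y) : ∃ σ : Equiv.Perm ι, ∀ i, y (σ i) = x i := by
  classical
  have hcard : ∀ b, Fintype.card {i // x i = b} = Fintype.card {i // y i = b} := fun b => by
    have := congrArg (Multiset.count b) h
    rw [Multiset.count_map, Multiset.count_map] at this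
    simp only [Fintype.card_subtype, eq_comm (b := b)]
    exact this
  exact ⟨Equiv.ofFiberEquiv fun b => Fintype.equivOfCardEq (hcard b),
    fun i => Equiv.ofFiberEquiv_map _ i⟩

theorem Polynomial.exists_common_root_of_resultant_eq_zero {K : Type*} [Field K] [IsAlgClosed K]
    {f g : Polynomial K} (h : f.resultant g = 0) : ∃ t, f.eval t = 0 ∧ g.eval t = 0 := by
  by_contra! hne
  refine (Polynomial.resultant_eq_zero_iff.1 h).2 ?_
  rw [Polynomial.isCoprime_iff_aeval_ne_zero_of_isAlgClosed K K]
  intro t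
  simp only [Polynomial.coe_aeval_eq_eval]
  by_cases h0 : f.eval t = 0
  · exact Or.inr (hne t h0)
  · exact Or.inl h0

theorem Polynomial.resultant_eq_zero_of_common_root {R : Type*} [CommRing R]
    {f g : Polynomial R} (hf : f.natDegree ≠ 0) {t : R} (h1 : f.eval t = 0) (h2 : g.eval t = 0) :
    f.resultant g = 0 := by
  obtain ⟨a, b, -, -, hab⟩ :=
    Polynomial.exists_mul_add_mul_eq_C_resultant f g le_rfl le_rfl (Or.inl hf)
  simpa [h1, h2] using (congrArg (Polynomial.eval t) hab).symm

/-- Gauss's lemma keeps `f` irreducible over the fraction field, where a zero resultant excludes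
coprimality; monicity brings the divisibility back to `R`. -/
theorem Polynomial.Monic.dvd_of_resultant_eq_zero {R : Type*} [CommRing R] [IsDomain R]
    [IsIntegrallyClosed R] {f g : Polynomial R} (hf : f.Monic) (hirr : Irreducible f)
    (hg : g.Monic) (h : f.resultant g = 0) : f ∣ g := by
  let K := FractionRing R
  have hK : (f.map (algebraMap R K)).resultant (g.map (algebraMap R K)) = 0 := by
    rw [hf.natDegree_map, hg.natDegree_map, Polynomial.resultant_map_map, h, map_zero]
  refine hg.dvd_of_fraction_map_dvd_fraction_map (K := K) hf ?_
  have hi := (hf.irreducible_iff_irreducible_map_fraction_map (K := K)).1 hirr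
  by_contra hnd
  exact (Polynomial.resultant_eq_zero_iff.1 hK).2 (hi.coprime_iff_not_dvd.2 hnd)

theorem MvPolynomial.eval_smul_of_isHomogeneous {K σ : Type*} [CommRing K] {f : MvPolynomial σ K}
    {D : ℕ} (hf : f.IsHomogeneous D) (l : K) (v : σ → K) :
    eval (l • v) f = l ^ D * eval v f := by
  rw [eval_eq, eval_eq, Finset.mul_sum]
  refine Finset.sum_congr rfl fun e he => ?_
  have hdeg : ∑ i ∈ e.support, e i = D := by
    rw [← hf (mem_support_iff.1 he), Finsupp.weight_apply]
    simp [Finsupp.sum]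
  simp only [Pi.smul_apply, smul_eq_mul, mul_pow]
  rw [Finset.prod_mul_distrib, Finset.prod_pow_eq_pow_sum, hdeg, mul_left_comm]

/-- A polynomial over an infinite field that scales with weight `D` is homogeneous. -/
theorem MvPolynomial.isHomogeneous_of_eval_smul {K σ : Type*} [Field K] [Infinite K]
    {f : MvPolynomial σ K} {D : ℕ}
    (h : ∀ (l : K), l ≠ 0 → ∀ v : σ → K, eval (l • v) f = l ^ D * eval v f) :
    f.IsHomogeneous D := by
  have key : ∀ i, i ≠ D → homogeneousComponent i f = 0 := by
    intro i hi
    refine MvPolynomial.funext fun v => ?_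
    -- Along the ray through `v` both sides are polynomials in the scaling factor; comparing
    -- coefficients kills each component of degree other than `D`.
    have hpoly : (∑ j ∈ Finset.range (f.totalDegree + 1),
        Polynomial.C (eval v (homogeneousComponent j f)) * Polynomial.X ^ j) =
        Polynomial.C (eval v f) * Polynomial.X ^ D := by
      refine Polynomial.eq_of_infinite_eval_eq _ _
        ((Set.finite_singleton (0 : K)).infinite_compl.mono fun l hl => ?_)
      have h1 := h l hl v
      conv_lhs at h1 => rw [← sum_homogeneousComponent f]
      rw [map_sum] at h1
      simp only [Set.mem_ofPred_eq, Polynomial.eval_finsetSum, Polynomial.eval_mul,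
        Polynomial.eval_C, Polynomial.eval_pow, Polynomial.eval_X]
      rw [mul_comm, ← h1]
      refine Finset.sum_congr rfl fun j _ => ?_
      rw [eval_smul_of_isHomogeneous (homogeneousComponent_isHomogeneous j f), mul_comm]
    have hco := congrArg (Polynomial.coeff · i) hpoly
    simp only [Polynomial.finsetSum_coeff, Polynomial.coeff_C_mul_X_pow, if_neg hi,
      Finset.sum_ite_eq, Finset.mem_range] at hco
    rw [map_zero]
    split_ifs at hco with hlt
    · exact hco
    · rw [homogeneousComponent_eq_zero _ _ (by omega), map_zero]
  rw [← sum_homogeneousComponent f]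
  refine IsHomogeneous.sum _ _ _ fun j _ => ?_
  by_cases hj : j = D
  · exact hj ▸ homogeneousComponent_isHomogeneous j f
  · rw [key j hj]
    exact isHomogeneous_zero _ _ _

/-! ### The dual curve `r(A;c) = 0`: homogeneity, special points, divisibility. -/

namespace WeightedNR

section Algebra

variable {n m : ℕ} (A : Matrix (Fin n) (Fin n) ℂ) (B : Matrix (Fin m) (Fin m) ℂ)
  (c : Fin n → ℝ) (d : Fin m → ℝ)

theorem comp_mem_rearrangements {e : Fin n → ℝ} (he : e ∈ rearrangements c)
    (σ : Equiv.Perm (Fin n)) : e ∘ σ ∈ rearrangements c := by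
  simp only [rearrangements, Finset.mem_image, Finset.mem_univ, true_and] at he ⊢
  obtain ⟨τ, rfl⟩ := he
  exact ⟨σ.trans τ, rfl⟩

theorem cDeg_ne_zero : cDeg A c ≠ 0 := by
  rw [cDeg_eq_card]
  exact Finset.card_ne_zero_of_mem (Finset.mem_image_of_mem _ (Finset.mem_univ 1))

/-- Rearrangements of `c` are counted formally, so coinciding eigenvalues never lower the degree.
Resultants of fixed formal degrees therefore specialise correctly. -/
theorem cDeg_congr (M : Matrix (Fin n) (Fin n) ℂ) : (cPoly M c).natDegree = cDeg A c := by
  rw [← cDeg, cDeg_eq_card, cDeg_eq_card]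

theorem monic_cPoly : (cPoly A c).Monic :=
  Polynomial.monic_prod_of_monic _ _ fun _ _ => Polynomial.monic_X_sub_C _

/-- The `c`-polynomial does not depend on the order of the eigenvalues. -/
theorem cPoly_eq_of_roots {x : Fin n → ℂ} (hx : Finset.univ.val.map x = A.charpoly.roots) :
    cPoly A c = ∏ e ∈ rearrangements c,
      (Polynomial.X - Polynomial.C (∑ j, (e j : ℂ) * x j)) := by
  obtain ⟨σ, hσ⟩ := Multiset.exists_perm_of_map_univ_eq ((map_eig A).trans hx.symm)
  refine Finset.prod_bij' (fun e _ => e ∘ σ.symm) (fun e _ => e ∘ σ)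
    (fun e he => comp_mem_rearrangements c he _) (fun e he => comp_mem_rearrangements c he _)
    (fun e _ => by ext; simp) (fun e _ => by ext; simp) fun e _ => ?_
  congr 2
  rw [← Equiv.sum_comp σ (fun j => (((e ∘ σ.symm) j : ℝ) : ℂ) * x j)]
  simp [hσ]

/-- Both multisets belong to the same monic polynomial, because `det(t - lA) = l^n det(t/l - A)`. -/
theorem map_mul_eig {l : ℂ} (hl : l ≠ 0) :
    Finset.univ.val.map (fun j => l * eig A j) = (l • A).charpoly.roots := by
  have h1 : ∀ M : Matrix (Fin n) (Fin n) ℂ,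
      M.charpoly = (M.charpoly.roots.map fun a => Polynomial.X - Polynomial.C a).prod := fun M =>
    (IsAlgClosed.splits M.charpoly).eq_prod_roots_of_monic M.charpoly_monic
  have h2 : (l • A).charpoly = ((Finset.univ.val.map fun j => l * eig A j).map
      fun a => Polynomial.X - Polynomial.C a).prod := by
    refine Polynomial.funext fun t => ?_
    have h3 : Matrix.scalar (Fin n) t - l • A = l • (Matrix.scalar (Fin n) (t / l) - A) := by
      rw [smul_sub, Matrix.scalar_apply, Matrix.scalar_apply, ← Matrix.smul_one_eq_diagonal,
        ← Matrix.smul_one_eq_diagonal, smul_smul, mul_div_cancel₀ _ hl]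
    rw [Matrix.eval_charpoly, h3, Matrix.det_smul, ← Matrix.eval_charpoly, h1 A, ← map_eig]
    simp only [Multiset.map_map, Function.comp_def]
    change _ * Polynomial.eval _ (∏ j, (Polynomial.X - Polynomial.C (eig A j))) =
      Polynomial.eval _ (∏ j, (Polynomial.X - Polynomial.C (l * eig A j)))
    simp only [Polynomial.eval_prod, Polynomial.eval_sub, Polynomial.eval_X, Polynomial.eval_C]
    rw [← Finset.card_univ, ← Finset.prod_const, ← Finset.prod_mul_distrib]
    refine Finset.prod_congr rfl fun j _ => ?_
    rw [mul_sub, mul_div_cancel₀ _ hl]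
  rw [h2, Polynomial.roots_multiset_prod_X_sub_C]

theorem eval_cPoly_smul {l : ℂ} (hl : l ≠ 0) (t : ℂ) :
    (cPoly (l • A) c).eval (l * t) = l ^ cDeg A c * (cPoly A c).eval t := by
  rw [cPoly_eq_of_roots _ c (map_mul_eig A hl), cPoly, Polynomial.eval_prod, Polynomial.eval_prod,
    cDeg_eq_card, ← Finset.prod_const, ← Finset.prod_mul_distrib]
  refine Finset.prod_congr rfl fun e _ => ?_
  simp only [Polynomial.eval_sub, Polynomial.eval_X, Polynomial.eval_C]
  rw [mul_sub, Finset.mul_sum]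
  congr 1
  exact Finset.sum_congr rfl fun j _ => by ring

theorem isHomogeneous_rPoly : (rPoly A c).IsHomogeneous (cDeg A c) := by
  refine MvPolynomial.isHomogeneous_of_eval_smul fun l hl v => ?_
  have hv : ∀ w : Fin 3 → ℂ, w = ![w 0, w 1, w 2] := fun w => by
    ext i; fin_cases i <;> rfl
  rw [hv (l • v), hv v, eval_rPoly, eval_rPoly]
  have h : (l * v 0) • A + (l * v 1) • Aᴴ = l • (v 0 • A + v 1 • Aᴴ) := by
    rw [smul_add, smul_smul, smul_smul]
  simp only [Pi.smul_apply, smul_eq_mul, Matrix.cons_val]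
  rw [h, eval_cPoly_smul _ c hl, cDeg_eq_card, cDeg_eq_card]

theorem restrictLine_rPoly (y : ℂ) :
    MvPolynomial.restrictLine (RingHom.id ℂ) y 0 (rPoly A c) =
      cPoly ((1 : ℂ) • A + y • Aᴴ) c := by
  refine Polynomial.funext fun t => ?_
  rw [MvPolynomial.eval_restrictLine, zero_mul, add_zero, MvPolynomial.eval₂_id, eval_rPoly]

/-- The support value is a `c`-value of `H_θ(A)`. -/
theorem eval_cPoly_rotHerm (θ : ℝ) :
    (cPoly (rotHerm A θ) c).eval (supportValue A c θ : ℂ) = 0 := by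
  have hroots : Finset.univ.val.map (fun j => (sortedEig A θ j : ℂ)) =
      (rotHerm A θ).charpoly.roots := by
    rw [(rotHerm_isHermitian A θ).roots_charpoly_eq_eigenvalues₀]
    rw [← Multiset.map_univ_val_equiv (finCongr (Fintype.card_fin n).symm), Multiset.map_map]
    rfl
  rw [cPoly_eq_of_roots _ c hroots, Polynomial.eval_prod]
  refine Finset.prod_eq_zero (i := c) (Finset.mem_image.2 ⟨1, Finset.mem_univ _, rfl⟩) ?_
  simp [supportValue, Polynomial.eval_finsetSum]

theorem eval_rPoly_dual_point (θ : ℝ) :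
    MvPolynomial.eval ![1, Complex.exp (-(θ * Complex.I)) ^ 2,
      2 * ((supportValue A c θ : ℂ) * Complex.exp (-(θ * Complex.I)))] (rPoly A c) = 0 := by
  have h : (1 : ℂ) • A + (Complex.exp (-(θ * Complex.I)) ^ 2) • Aᴴ =
      (2 * Complex.exp (-(θ * Complex.I))) • rotHerm A θ := by
    have h1 : Complex.exp (-(θ * Complex.I)) * Complex.exp (θ * Complex.I) = 1 := by
      rw [← Complex.exp_add, neg_add_cancel, Complex.exp_zero]
    rw [rotHerm, smul_smul, smul_add, smul_smul, smul_smul]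
    congr 2
    · linear_combination -h1
    · ring
  rw [eval_rPoly, h, show (2 : ℂ) * ((supportValue A c θ : ℂ) * Complex.exp (-(θ * Complex.I))) =
    (2 * Complex.exp (-(θ * Complex.I))) * supportValue A c θ by ring,
    eval_cPoly_smul _ c (mul_ne_zero two_ne_zero (Complex.exp_ne_zero _)), eval_cPoly_rotHerm,
    mul_zero]

variable {A B c d} in
/-- The geometric hypothesis forces the two dual curves to meet on every line `y = const`. -/
theorem exists_common_root {z : Fin (cDeg A c * cDeg B d + 1) → ℂ}
    (hz : ∀ r, z r ∈ frontier (weightedRange A c) ∩ frontier (weightedRange B d))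
    (hseg : ∀ r s, r ≠ s → ¬ segment ℝ (z r) (z s) ⊆
      frontier (weightedRange A c) ∩ frontier (weightedRange B d)) (y : ℂ) :
    ∃ t, (cPoly ((1 : ℂ) • A + y • Aᴴ) c).eval t = 0 ∧
      (cPoly ((1 : ℂ) • B + y • Bᴴ) d).eval t = 0 := by
  -- Both degrees are positive, so there are at least two points, as the case of opposite support
  -- directions requires.
  have : Nontrivial (Fin (cDeg A c * cDeg B d + 1)) := Fin.nontrivial_iff_two_le.2 <| by
    have := Nat.pos_of_ne_zero (mul_ne_zero (cDeg_ne_zero A c) (cDeg_ne_zero B d))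
    omega
  choose θ hθ hsep using exists_common_supportValue hz hseg
  have hW : ∀ r, z r ∈ weightedRange A c := fun r =>
    isClosed_weightedRange.frontier_subset (hz r).1
  have hres := MvPolynomial.resultant_restrictLine_eq_zero
    (isHomogeneous_rPoly A c).totalDegree_le (isHomogeneous_rPoly B d).totalDegree_le
    (Or.inl (cDeg_ne_zero A c)) (p := fun r => Complex.exp (-(θ r * Complex.I)) ^ 2)
    (q := fun r => 2 * ((supportValue A c (θ r) : ℂ) * Complex.exp (-(θ r * Complex.I))))
    (fun r s h1 h2 => by
      by_contra hrs
      exact eq_of_dual_point_eq (hW r) (hW s) (hsep r s (Ne.symm hrs)) (hsep s r hrs) h1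
        (mul_left_cancel₀ two_ne_zero h2))
    (by rw [Fintype.card_fin]; exact Nat.lt_succ_self _)
    (fun r => eval_rPoly_dual_point A c (θ r))
    (fun r => by rw [hθ r]; exact eval_rPoly_dual_point B d (θ r)) y
  rw [restrictLine_rPoly, restrictLine_rPoly, ← cDeg_congr A c ((1 : ℂ) • A + y • Aᴴ),
    ← cDeg_congr B d ((1 : ℂ) • B + y • Bᴴ)] at hres
  exact Polynomial.exists_common_root_of_resultant_eq_zero hres

/-- `ℂ[x, y, t]` as polynomials in `t` with coefficients in `ℂ[y, x]`. -/
noncomputable def tEquiv : MvPolynomial (Fin 3) ℂ ≃ₐ[ℂ] Polynomial (MvPolynomial (Fin 2) ℂ) :=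
  (MvPolynomial.renameEquiv ℂ (Equiv.swap (0 : Fin 3) 2)).trans (MvPolynomial.finSuccEquiv ℂ 2)

theorem map_tEquiv_rPoly (s : Fin 2 → ℂ) :
    (tEquiv (rPoly A c)).map (MvPolynomial.eval s) = cPoly (s 1 • A + s 0 • Aᴴ) c := by
  refine Polynomial.funext fun t => ?_
  rw [tEquiv, AlgEquiv.trans_apply, ← MvPolynomial.eval_eq_eval_mv_eval',
    MvPolynomial.renameEquiv_apply, MvPolynomial.eval_rename, ← eval_rPoly]
  congr 2
  ext i
  fin_cases i <;> rfl

theorem coeff_tEquiv_rPoly (s : Fin 2 → ℂ) (k : ℕ) :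
    MvPolynomial.eval s ((tEquiv (rPoly A c)).coeff k) =
      (cPoly (s 1 • A + s 0 • Aᴴ) c).coeff k := by
  rw [← map_tEquiv_rPoly, Polynomial.coeff_map]

theorem monic_tEquiv_rPoly :
    (tEquiv (rPoly A c)).Monic ∧ (tEquiv (rPoly A c)).natDegree = cDeg A c := by
  have h1 : (tEquiv (rPoly A c)).coeff (cDeg A c) = 1 := by
    refine MvPolynomial.funext fun s => ?_
    rw [coeff_tEquiv_rPoly, map_one, ← cDeg_congr A c (s 1 • A + s 0 • Aᴴ)]
    exact monic_cPoly _ c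
  have h2 : (tEquiv (rPoly A c)).natDegree ≤ cDeg A c := by
    refine Polynomial.natDegree_le_iff_coeff_eq_zero.2 fun k hk => MvPolynomial.funext fun s => ?_
    rw [coeff_tEquiv_rPoly, map_zero, Polynomial.coeff_eq_zero_of_natDegree_lt]
    rwa [cDeg_congr A c]
  exact ⟨Polynomial.monic_of_natDegree_le_of_coeff_eq_one _ h2 h1,
    h2.antisymm (Polynomial.le_natDegree_of_ne_zero (by rw [h1]; exact one_ne_zero))⟩

variable {A B c d} in
theorem cPoly_dvd_cPoly (hirr : Irreducible (rPoly A c))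
    (h : ∀ y : ℂ, ∃ t, (cPoly ((1 : ℂ) • A + y • Aᴴ) c).eval t = 0 ∧
      (cPoly ((1 : ℂ) • B + y • Bᴴ) d).eval t = 0) : cPoly A c ∣ cPoly B d := by
  set F := tEquiv (rPoly A c) with hF
  set G := tEquiv (rPoly B d) with hG
  obtain ⟨hFm, hFd⟩ := monic_tEquiv_rPoly A c
  obtain ⟨hGm, hGd⟩ := monic_tEquiv_rPoly B d
  have hFirr : Irreducible F := (MulEquiv.irreducible_iff tEquiv).2 hirr
  have hres : F.resultant G = 0 := by
    -- Here `X 1` is `x`. The common roots are known only for `x = 1`, hence by homogeneity for `x ≠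
    -- 0`; the factor `x` covers the remaining locus and is cancelled afterwards.
    have h1 : MvPolynomial.X 1 * F.resultant G = 0 := by
      refine MvPolynomial.funext fun s => ?_
      rw [map_mul, MvPolynomial.eval_X, map_zero]
      by_cases hs : s 1 = 0
      · rw [hs, zero_mul]
      obtain ⟨t, htA, htB⟩ := h (s 0 / s 1)
      have hscale : ∀ {k : ℕ} (M : Matrix (Fin k) (Fin k) ℂ),
          s 1 • M + s 0 • Mᴴ = s 1 • ((1 : ℂ) • M + (s 0 / s 1) • Mᴴ) := fun M => by
        rw [smul_add, smul_smul, smul_smul, mul_one, mul_div_cancel₀ _ hs]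
      rw [← Polynomial.resultant_map_map, hFd, hGd, map_tEquiv_rPoly, map_tEquiv_rPoly,
        ← cDeg_congr A c (s 1 • A + s 0 • Aᴴ), ← cDeg_congr B d (s 1 • B + s 0 • Bᴴ),
        Polynomial.resultant_eq_zero_of_common_root (t := s 1 * t), mul_zero]
      · rw [cDeg_congr A c]
        exact cDeg_ne_zero A c
      · rw [hscale, eval_cPoly_smul _ c hs, htA, mul_zero]
      · rw [hscale, eval_cPoly_smul _ d hs, htB, mul_zero]
    exact (mul_eq_zero.1 h1).resolve_left (MvPolynomial.X_ne_zero 1)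
  have hdvd : F ∣ G := hFm.dvd_of_resultant_eq_zero hFirr hGm hres
  have := Polynomial.map_dvd (MvPolynomial.eval ![0, 1]) hdvd
  rw [hF, hG, map_tEquiv_rPoly, map_tEquiv_rPoly] at this
  simpa using this

end Algebra

end WeightedNR

theorem mainTheorem2 (n m : ℕ) (A : Matrix (Fin n) (Fin n) ℂ) (B : Matrix (Fin m) (Fin m) ℂ)
    (c : Fin n → ℝ) (d : Fin m → ℝ)
    (z : Fin (WeightedNR.cDeg A c * WeightedNR.cDeg B d + 1) → ℂ)
    (hz : ∀ r, z r ∈ frontier (WeightedNR.weightedRange A c) ∩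
      frontier (WeightedNR.weightedRange B d))
    (hseg : ∀ r s, r ≠ s → ¬ segment ℝ (z r) (z s) ⊆
      frontier (WeightedNR.weightedRange A c) ∩ frontier (WeightedNR.weightedRange B d)) :
    (∃ μ : ℂ, WeightedNR.IsCValue A c μ ∧ WeightedNR.IsCValue B d μ) ∧
      (Irreducible (WeightedNR.rPoly A c) →
        ∀ μ : ℂ, WeightedNR.IsCValue A c μ → WeightedNR.IsCValue B d μ) := by
  have hcommon := WeightedNR.exists_common_root hz hseg
  simp only [← WeightedNR.isRoot_cPoly]
  constructor
  · obtain ⟨t, hA, hB⟩ := hcommon 0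
    rw [one_smul, zero_smul, add_zero] at hA hB
    exact ⟨t, hA, hB⟩
  · exact fun hirr μ hμ => hμ.dvd (WeightedNR.cPoly_dvd_cPoly hirr hcommon)
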